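/- Let $(\Omega,\mathcal F,\mathbb P)$ be an atomless probability space, $\mathcal X=L^\infty(\Omega,\mathcal F,\mathbb P)$, and let $X_1,\dots,X_n\in\mathcal X$ be initial endowments with aggregate $S=\sum_{i=1}^n X_i$. Let $\mathcal A=\{(Y_i)_{i=1}^n\in\mathcal X^n:\sum_{i=1}^n Y_i=S\}$ be the set of allocations, and let $\mathcal A_C\subseteq\mathcal A$ be the set of comonotone allocations, i.e. those $(Y_i)$ having versions with $[Y_i(\omega_1)-Y_i(\omega_2)]\,[Y_j(\omega_1)-Y_j(\omega_2)]\ge 0$ for all $\omega_1,\omega_2\in\Omega$ and all $i,j$. For each $i$ let $U_i:\mathcal X\to\mathbb R$ be a utility functional such that - $U_i$ is concave; - $U_i$ is S.S.D. preserving: $U_i(Z_1)\le U_i(Z_2)$ whenever $Z_1,Z_2\in\mathcal X$ satisfy $\mathbb E[\phi(Z_1)]\le\mathbb E[\phi(Z_2)]$ for every nondecreasing concave $\phi:\mathbb R\to\mathbb R$ for which these expectations are defined; - for every $Z\in\mathcal X$ the function $c\mapsto U_i(Z+c)$ on $\mathbb R$ is continuous, strictly increasing, and tends to $\infty$ as $c\to\infty$.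 Let $\mathcal{IR}=\{(Y_i)\in\mathcal A: U_i(Y_i)\ge U_i(X_i)\ \forall i\}$ be the set of individually rational allocations. Let $\mathcal{PO}$ be the set of $(Y_i^*)\in\mathcal{IR}$ for which there is no $(Y_i)\in\mathcal{IR}$ with $U_i(Y_i)\ge U_i(Y_i^*)$ for all $i$ and strict inequality for at least one $i$. Let $\mathcal{CPO}$ be the set of $(Y_i^*)\in\mathcal{IR}\cap\mathcal A_C$ for which there is no such $(Y_i)$ in $\mathcal{IR}\cap\mathcal A_C$. Then $\mathcal{PO}\neq\varnothing$ if and only if $\mathcal{CPO}\neq\varnothing$. Furthermore, when both sets are nonempty, for every $\lambda\in\mathbb R_+^n\setminus\{0\}$, $$\sup_{(Y_i)\in\mathcal{IR}}\ \sum_{i=1}^n\lambda_i\,U_i(Y_i)\;=\;\sup_{(Y_i)\in\mathcal{IR}\cap\mathcal A_C}\ \sum_{i=1}^n\lambda_i\,U_i(Y_i),$$ as an equality in $(-\infty,+\infty]$. -/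

import Mathlib

open MeasureTheory Filter
open scoped ENNReal BigOperators

noncomputable section

namespace RiskSharing

variable {Ω : Type*} [MeasurableSpace Ω]

/-- A measure is atomless if every measurable set of positive measure contains a measurable
subset of strictly smaller positive measure. -/
def Atomless (μ : Measure Ω) : Prop :=
  ∀ A : Set Ω, MeasurableSet A → 0 < μ A →
    ∃ B : Set Ω, B ⊆ A ∧ MeasurableSet B ∧ 0 < μ B ∧ μ B < μ A

/-- The space `L^∞(μ)` of essentially bounded real random variables (up to a.s. equality). -/
abbrev LInfty (μ : Measure Ω) : Type _ := Lp ℝ (⊤ : ℝ≥0∞) μ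

/-- `ICVLe μ Z₁ Z₂`: `Z₂` dominates `Z₁` in the increasing concave order. -/
def ICVLe (μ : Measure Ω) (Z₁ Z₂ : LInfty μ) : Prop :=
  ∀ φ : ℝ → ℝ, Monotone φ → ConcaveOn ℝ Set.univ φ →
    Integrable (fun ω => φ (Z₁ ω)) μ → Integrable (fun ω => φ (Z₂ ω)) μ →
      ∫ ω, φ (Z₁ ω) ∂μ ≤ ∫ ω, φ (Z₂ ω) ∂μ

/-- `U` is S.S.D. preserving: consistent with the increasing concave order. -/
def SSDPreserving (μ : Measure Ω) (U : LInfty μ → ℝ) : Prop :=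
  ∀ Z₁ Z₂ : LInfty μ, ICVLe μ Z₁ Z₂ → U Z₁ ≤ U Z₂

/-- For every `Z`, the function `c ↦ U (Z + c)` is continuous, strictly increasing and tends
to `∞` as `c → ∞`. -/
def IncreasingInCash (μ : Measure Ω) [IsFiniteMeasure μ] (U : LInfty μ → ℝ) : Prop :=
  ∀ Z : LInfty μ,
    Continuous (fun c : ℝ => U (Z + Lp.const (⊤ : ℝ≥0∞) μ c)) ∧
    StrictMono (fun c : ℝ => U (Z + Lp.const (⊤ : ℝ≥0∞) μ c)) ∧
    Tendsto (fun c : ℝ => U (Z + Lp.const (⊤ : ℝ≥0∞) μ c)) atTop atTop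

variable {μ : Measure Ω} {n : ℕ}

/-- Allocations of the aggregate endowment `∑ i, X i`. -/
def allocations (X : Fin n → LInfty μ) : Set (Fin n → LInfty μ) :=
  {Y | ∑ i, Y i = ∑ i, X i}

/-- A vector of elements of `L^∞` is comonotone if its components have versions that are
comonotone random variables: any two of them never move in opposite directions. -/
def Comonotone (Y : Fin n → LInfty μ) : Prop :=
  ∃ Z : Fin n → Ω → ℝ, (∀ i, Measurable (Z i)) ∧ (∀ i, Y i =ᵐ[μ] Z i) ∧
    ∀ (ω₁ ω₂ : Ω) (i j : Fin n), 0 ≤ (Z i ω₁ - Z i ω₂) * (Z j ω₁ - Z j ω₂)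

/-- Comonotone allocations. -/
def comonotoneAllocations (X : Fin n → LInfty μ) : Set (Fin n → LInfty μ) :=
  {Y | Y ∈ allocations X ∧ Comonotone Y}

/-- Individually rational allocations. -/
def IR (U : Fin n → LInfty μ → ℝ) (X : Fin n → LInfty μ) : Set (Fin n → LInfty μ) :=
  {Y | Y ∈ allocations X ∧ ∀ i, U i (X i) ≤ U i (Y i)}

/-- `Y` Pareto dominates `Y'`. -/
def Dominates (U : Fin n → LInfty μ → ℝ) (Y Y' : Fin n → LInfty μ) : Prop :=
  (∀ i, U i (Y' i) ≤ U i (Y i)) ∧ ∃ i, U i (Y' i) < U i (Y i)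

/-- Pareto-optimal allocations. -/
def PO (U : Fin n → LInfty μ → ℝ) (X : Fin n → LInfty μ) : Set (Fin n → LInfty μ) :=
  {Y | Y ∈ IR U X ∧ ¬ ∃ Y' ∈ IR U X, Dominates U Y' Y}

/-- Comonotone Pareto-optimal allocations. -/
def CPO (U : Fin n → LInfty μ → ℝ) (X : Fin n → LInfty μ) : Set (Fin n → LInfty μ) :=
  {Y | Y ∈ IR U X ∩ comonotoneAllocations X ∧
    ¬ ∃ Y' ∈ IR U X ∩ comonotoneAllocations X, Dominates U Y' Y}

/-- Weight vectors: nonnegative and nonzero. -/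
def weights (n : ℕ) : Set (Fin n → ℝ) :=
  {l | ∀ i, 0 ≤ l i} \ {0}

/-- The supremum, in the extended reals, of the `l`-weighted sum of utilities over a set of
allocations. -/
def weightedSup (U : Fin n → LInfty μ → ℝ) (l : Fin n → ℝ) (C : Set (Fin n → LInfty μ)) :
    EReal :=
  ⨆ Y ∈ C, ((∑ i, l i * U i (Y i) : ℝ) : EReal)

end RiskSharing

end

namespace RiskSharing

/-! ### Slopes of concave functions -/

section ConcaveFunctions

variable {φ : ℝ → ℝ}

/-! Everything rests on comonotone improvement (`exists_comonotone_improvement`): replacing an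
allocation by a comonotone one that is better for every agent in the concave order turns questions
about `IR` into questions about `IR` intersected with comonotone allocations.

The improvement comes from a projection in the Hilbert space L². The uniformly bounded allocations
that improve on `Y` form a nonempty closed convex set, so it has an element `f` of least norm. If
two components of `f` were oppositely ordered on two sets of positive measure, a small
mean-preserving transfer between them would stay in the set (`integral_le_integral_add_transfer`)
while having negative inner product with `f`, against minimality (`measure_eq_zero_or_of_minimal`).
Hence `f` is almost surely ordered alike, and changing it on a null set makes it comonotone
(`exists_comonotone_versions`). -/

lemma slope_le_slope_of_concaveOn (hφ : ConcaveOn ℝ Set.univ φ) {a b c d : ℝ} (hab : a < b)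
    (hbc : b ≤ c) (hcd : c < d) : (φ d - φ c) / (d - c) ≤ (φ b - φ a) / (b - a) := by
  rcases hbc.eq_or_lt with rfl | hbc
  · exact hφ.slope_anti_adjacent (Set.mem_univ _) (Set.mem_univ _) hab hcd
  · exact (hφ.slope_anti_adjacent (Set.mem_univ _) (Set.mem_univ _) hbc hcd).trans
      (hφ.slope_anti_adjacent (Set.mem_univ _) (Set.mem_univ _) hab hbc)

/-- The slopes of a concave function on the right of `c` and those on the left of `c` are
separated by a number `p`. -/
lemma exists_slope_bound (hφ : ConcaveOn ℝ Set.univ φ) {c δ s t : ℝ} (hs : 0 < s) (hsδ : s < δ)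
    (ht : 0 < t) (htδ : t ≤ δ) :
    ∃ p : ℝ, (∀ x, c + δ ≤ x → φ x - p * s ≤ φ (x - s)) ∧
      ∀ y, y ≤ c - δ → φ y + p * t ≤ φ (y + t) := by
  -- The chord over `[c, c + δ - s]`: it is nondegenerate as `s < δ`, lies left of `[x - s, x]` and
  -- right of `[y, y + t]`.
  refine ⟨(φ (c + (δ - s)) - φ c) / (c + (δ - s) - c), fun x hx => ?_, fun y hy => ?_⟩
  · have h := slope_le_slope_of_concaveOn hφ (a := c) (b := c + (δ - s)) (c := x - s) (d := x)
      (by linarith) (by linarith) (by linarith)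
    rw [sub_sub_cancel, div_le_iff₀ hs] at h
    linarith
  · have h := slope_le_slope_of_concaveOn hφ (a := y) (b := y + t) (c := c) (d := c + (δ - s))
      (by linarith) (by linarith) (by linarith)
    rw [add_sub_cancel_left (a := y), le_div_iff₀ ht] at h
    linarith

lemma continuous_of_concaveOn (hφ : ConcaveOn ℝ Set.univ φ) : Continuous φ :=
  hφ.locallyLipschitz.continuous

lemma exists_bound_of_continuous (hφ : Continuous φ) (M : ℝ) :
    ∃ C, ∀ x, |x| ≤ M → ‖φ x‖ ≤ C := by
  obtain ⟨C, hC⟩ := (isCompact_Icc (a := -M) (b := M)).exists_bound_of_continuousOn hφ.continuousOn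
  exact ⟨C, fun x hx => hC x (abs_le.1 hx)⟩

end ConcaveFunctions

/-! ### Mean-preserving transfers -/

section Transfer

variable {Ω : Type*}

/-- Move the amount `s` out of `A` and the amount `t` into `B`. -/
noncomputable def transfer (A B : Set Ω) (s t : ℝ) : Ω → ℝ :=
  fun ω => B.indicator (fun _ => t) ω - A.indicator (fun _ => s) ω

lemma transfer_swap_neg (A B : Set Ω) (s t : ℝ) (ω : Ω) :
    transfer B A t s ω = - transfer A B s t ω := by
  simp [transfer]

lemma abs_transfer_le (A B : Set Ω) (s t : ℝ) (ω : Ω) : |transfer A B s t ω| ≤ |s| + |t| := by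
  have h1 : |B.indicator (fun _ => t) ω| ≤ |t| := by
    by_cases h : ω ∈ B <;> simp [h]
  have h2 : |A.indicator (fun _ => s) ω| ≤ |s| := by
    by_cases h : ω ∈ A <;> simp [h]
  exact (abs_sub _ _).trans (by linarith)

/-- A moved value never crosses the level `c`, so it stays between `c` and its old value, both
bounded by `M`. -/
lemma abs_add_transfer_le {g : Ω → ℝ} {A B : Set Ω} {c δ s t M : ℝ} (hδ : 0 < δ)
    (hgA : ∀ ω ∈ A, c + δ ≤ g ω) (hgB : ∀ ω ∈ B, g ω ≤ c - δ) (hs : 0 ≤ s) (hsδ : s ≤ δ)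
    (ht : 0 ≤ t) (htδ : t ≤ δ) (hc : |c| ≤ M) {ω : Ω} (hM : |g ω| ≤ M) :
    |g ω + transfer A B s t ω| ≤ M := by
  rw [abs_le] at *
  by_cases hA : ω ∈ A <;> by_cases hB : ω ∈ B <;> simp only [transfer, hA, hB, not_false_eq_true,
    Set.indicator_of_mem, Set.indicator_of_notMem]
  · linarith [hgA ω hA, hgB ω hB]
  · have := hgA ω hA
    constructor <;> linarith
  · have := hgB ω hB
    constructor <;> linarith
  · constructor <;> linarith

variable [MeasurableSpace Ω] {μ : Measure Ω}

lemma integrable_comp_of_bounded [IsFiniteMeasure μ] {φ : ℝ → ℝ} (hφ : Continuous φ) {g : Ω → ℝ}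
    (hg : AEStronglyMeasurable g μ) {M : ℝ} (hM : ∀ᵐ ω ∂μ, |g ω| ≤ M) :
    Integrable (fun ω => φ (g ω)) μ := by
  obtain ⟨C, hC⟩ := exists_bound_of_continuous hφ M
  exact Integrable.of_bound (hφ.comp_aestronglyMeasurable hg) C (hM.mono fun ω h => hC _ h)

lemma measurable_transfer {A B : Set Ω} (hA : MeasurableSet A) (hB : MeasurableSet B) (s t : ℝ) :
    Measurable (transfer A B s t) :=
  (measurable_const.indicator hB).sub (measurable_const.indicator hA)

lemma integral_transfer [IsFiniteMeasure μ] {A B : Set Ω} (hA : MeasurableSet A)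
    (hB : MeasurableSet B) (s t : ℝ) :
    ∫ ω, transfer A B s t ω ∂μ = μ.real B * t - μ.real A * s := by
  unfold transfer
  rw [integral_sub ((integrable_const _).indicator hB) ((integrable_const _).indicator hA),
    integral_indicator_const _ hB, integral_indicator_const _ hA]
  simp

lemma integrable_transfer [IsFiniteMeasure μ] {A B : Set Ω} (hA : MeasurableSet A)
    (hB : MeasurableSet B) (s t : ℝ) : Integrable (transfer A B s t) μ :=
  ((integrable_const _).indicator hB).sub ((integrable_const _).indicator hA)

/-- A mean-preserving transfer from larger to smaller values increases the expectation of concave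
functions. -/
lemma integral_le_integral_add_transfer [IsFiniteMeasure μ] {φ : ℝ → ℝ}
    (hφ : ConcaveOn ℝ Set.univ φ) {g : Ω → ℝ} (hg : AEStronglyMeasurable g μ) {A B : Set Ω}
    (hA : MeasurableSet A) (hB : MeasurableSet B) {c δ s t M : ℝ} (hδ : 0 < δ)
    (hgA : ∀ ω ∈ A, c + δ ≤ g ω) (hgB : ∀ ω ∈ B, g ω ≤ c - δ) (hs : 0 < s) (hsδ : s < δ)
    (ht : 0 < t) (htδ : t ≤ δ) (hc : |c| ≤ M) (hM : ∀ᵐ ω ∂μ, |g ω| ≤ M)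
    (hst : μ.real B * t = μ.real A * s) :
    ∫ ω, φ (g ω) ∂μ ≤ ∫ ω, φ (g ω + transfer A B s t ω) ∂μ := by
  obtain ⟨p, hp₁, hp₂⟩ := exists_slope_bound (c := c) hφ hs hsδ ht htδ
  have hcont := continuous_of_concaveOn hφ
  have hi := integrable_comp_of_bounded hcont hg hM
  have htr := integrable_transfer (μ := μ) hA hB s t
  have hi' : Integrable (fun ω => φ (g ω + transfer A B s t ω)) μ :=
    integrable_comp_of_bounded hcont (hg.add htr.1)
      (hM.mono fun ω h => abs_add_transfer_le hδ hgA hgB hs.le hsδ.le ht.le htδ hc h)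
  -- One slope `p` serves both sets, and by `hst` the transfer has mean zero, so the linear term
  -- vanishes on integration.
  have hpt : ∀ ω, φ (g ω) + p * transfer A B s t ω ≤ φ (g ω + transfer A B s t ω) := by
    intro ω
    by_cases hA : ω ∈ A <;> by_cases hB : ω ∈ B <;> simp only [transfer, hA, hB,
      not_false_eq_true, Set.indicator_of_mem, Set.indicator_of_notMem]
    · linarith [hgA ω hA, hgB ω hB]
    · have := hp₁ (g ω) (hgA ω hA)
      rw [zero_sub, ← sub_eq_add_neg]
      linarith
    · simpa using hp₂ (g ω) (hgB ω hB)
    · simp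
  have := integral_mono (hi.add (htr.const_mul p)) hi' hpt
  have h2 : ∫ ω, (φ (g ω) + p * transfer A B s t ω) ∂μ = ∫ ω, φ (g ω) ∂μ := by
    rw [integral_add hi (htr.const_mul p), integral_const_mul, integral_transfer hA hB,
      hst]
    simp
  rw [← h2]
  exact this

end Transfer

/-! ### The convex set of improvements and its least-norm element -/

variable {Ω : Type*} [MeasurableSpace Ω] {μ : Measure Ω} {n : ℕ}

/-- The square-integrable vectors with components bounded by `M` and aggregate `S` whose
components dominate those of `Y` in the concave order. -/
def concaveImprovements (μ : Measure Ω) (M : ℝ) (S : Ω → ℝ) (Y : Fin n → Ω → ℝ) :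
    Set (Lp (EuclideanSpace ℝ (Fin n)) 2 μ) :=
  {f | (∀ᵐ ω ∂μ, ∑ i, f ω i = S ω) ∧ (∀ᵐ ω ∂μ, ∀ i, |f ω i| ≤ M) ∧
    ∀ i, ∀ φ : ℝ → ℝ, ConcaveOn ℝ Set.univ φ → ∫ ω, φ (Y i ω) ∂μ ≤ ∫ ω, φ (f ω i) ∂μ}

section Improvements

variable {M : ℝ} {S : Ω → ℝ} {Y : Fin n → Ω → ℝ}

lemma continuous_coord (i : Fin n) : Continuous fun v : EuclideanSpace ℝ (Fin n) => v i := by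
  fun_prop

lemma aestronglyMeasurable_apply {f : Ω → EuclideanSpace ℝ (Fin n)}
    (hf : AEStronglyMeasurable f μ) (i : Fin n) : AEStronglyMeasurable (fun ω => f ω i) μ :=
  (continuous_coord i).comp_aestronglyMeasurable hf

lemma convex_concaveImprovements [IsFiniteMeasure μ] :
    Convex ℝ (concaveImprovements μ M S Y) := by
  rintro f ⟨hf₁, hf₂, hf₃⟩ g ⟨hg₁, hg₂, hg₃⟩ a b ha hb hab
  have hae : ∀ᵐ ω ∂μ, (a • f + b • g : Lp (EuclideanSpace ℝ (Fin n)) 2 μ) ω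
      = a • f ω + b • g ω := by
    filter_upwards [Lp.coeFn_add (a • f) (b • g), Lp.coeFn_smul a f, Lp.coeFn_smul b g]
      with ω h1 h2 h3
    rw [h1, Pi.add_apply, h2, h3, Pi.smul_apply, Pi.smul_apply]
  have hbd : ∀ᵐ ω ∂μ, ∀ i, |(a • f + b • g : Lp (EuclideanSpace ℝ (Fin n)) 2 μ) ω i| ≤ M := by
    filter_upwards [hae, hf₂, hg₂] with ω h h1 h2 i
    rw [h]
    have h1 := abs_le.1 (h1 i)
    have h2 := abs_le.1 (h2 i)
    simp only [PiLp.add_apply, PiLp.smul_apply, smul_eq_mul]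
    have hb' : b = 1 - a := by linarith
    subst hb'
    rw [abs_le]
    constructor <;> nlinarith
  refine ⟨?_, hbd, fun i φ hφ => ?_⟩
  · filter_upwards [hae, hf₁, hg₁] with ω h h1 h2
    simp only [h, PiLp.add_apply, PiLp.smul_apply, smul_eq_mul, Finset.sum_add_distrib,
      ← Finset.mul_sum, h1, h2]
    rw [← add_mul, hab, one_mul]
  · have hcont := continuous_of_concaveOn hφ
    have hint : ∀ u : Lp (EuclideanSpace ℝ (Fin n)) 2 μ, (∀ᵐ ω ∂μ, ∀ i, |u ω i| ≤ M) →
        Integrable (fun ω => φ (u ω i)) μ := fun u hu =>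
      integrable_comp_of_bounded hcont (aestronglyMeasurable_apply (Lp.aestronglyMeasurable u) i)
        (hu.mono fun ω h => h i)
    have key : ∫ ω, (a * φ (f ω i) + b * φ (g ω i)) ∂μ
        ≤ ∫ ω, φ ((a • f + b • g : Lp (EuclideanSpace ℝ (Fin n)) 2 μ) ω i) ∂μ := by
      refine integral_mono_ae (((hint f hf₂).const_mul a).add ((hint g hg₂).const_mul b))
        (hint _ hbd) ?_
      filter_upwards [hae] with ω h
      simp only [h, PiLp.add_apply, PiLp.smul_apply]
      exact hφ.2 (Set.mem_univ _) (Set.mem_univ _) ha hb hab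
    rw [integral_add ((hint f hf₂).const_mul a) ((hint g hg₂).const_mul b), integral_const_mul,
      integral_const_mul] at key
    have h1 := mul_le_mul_of_nonneg_left (hf₃ i φ hφ) ha
    have h2 := mul_le_mul_of_nonneg_left (hg₃ i φ hφ) hb
    have h3 : a * (∫ ω, φ (Y i ω) ∂μ) + b * (∫ ω, φ (Y i ω) ∂μ) = ∫ ω, φ (Y i ω) ∂μ := by
      rw [← add_mul, hab, one_mul]
    linarith

/-- An L² limit is an almost sure limit along a subsequence; the uniform bound `M` then allows
dominated convergence for each `φ`. -/
lemma isClosed_concaveImprovements [IsFiniteMeasure μ] :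
    IsClosed (concaveImprovements μ M S Y) := by
  refine IsSeqClosed.isClosed fun u f hu hlim => ?_
  obtain ⟨k, -, hk⟩ := (tendstoInMeasure_of_tendsto_Lp hlim).exists_seq_tendsto_ae
  have hki : ∀ᵐ ω ∂μ, ∀ i, Tendsto (fun m => u (k m) ω i) atTop (nhds (f ω i)) := by
    filter_upwards [hk] with ω h i
    exact ((continuous_coord i).tendsto _).comp h
  have hbd : ∀ᵐ ω ∂μ, ∀ m i, |u (k m) ω i| ≤ M := ae_all_iff.2 fun m => (hu (k m)).2.1
  have hsum : ∀ᵐ ω ∂μ, ∀ m, ∑ i, u (k m) ω i = S ω := ae_all_iff.2 fun m => (hu (k m)).1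
  refine ⟨?_, ?_, fun i φ hφ => ?_⟩
  · filter_upwards [hki, hsum] with ω h hs
    refine tendsto_nhds_unique (tendsto_finsetSum _ fun i _ => h i) ?_
    simp [hs]
  · filter_upwards [hki, hbd] with ω h hb i
    exact le_of_tendsto (h i).abs (Eventually.of_forall fun m => hb m i)
  · have hcont := continuous_of_concaveOn hφ
    obtain ⟨C, hC⟩ := exists_bound_of_continuous hcont M
    have ht : Tendsto (fun m => ∫ ω, φ (u (k m) ω i) ∂μ) atTop (nhds (∫ ω, φ (f ω i) ∂μ)) := by
      refine tendsto_integral_of_dominated_convergence (fun _ => C) (fun m => ?_)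
        (integrable_const C) (fun m => ?_) ?_
      · exact hcont.comp_aestronglyMeasurable
          (aestronglyMeasurable_apply (Lp.aestronglyMeasurable _) i)
      · exact hbd.mono fun ω h => hC _ (h m i)
      · exact hki.mono fun ω h => (hcont.tendsto _).comp (h i)
    exact ge_of_tendsto ht (Eventually.of_forall fun m => (hu (k m)).2.2 i φ hφ)

/-- The direction in which mass is moved between the components `i` and `j`. -/
noncomputable def exchange (A B : Set Ω) (s t : ℝ) (i j : Fin n) (ω : Ω) : EuclideanSpace ℝ (Fin n) :=
  transfer A B s t ω • (EuclideanSpace.single i (1 : ℝ) - EuclideanSpace.single j (1 : ℝ))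

lemma memLp_exchange [IsFiniteMeasure μ] {A B : Set Ω} (hA : MeasurableSet A)
    (hB : MeasurableSet B) (s t : ℝ) (i j : Fin n) : MemLp (exchange A B s t i j) 2 μ := by
  refine MemLp.of_bound
    (((measurable_transfer hA hB s t).stronglyMeasurable.aestronglyMeasurable).smul_const _)
    ((|s| + |t|) * ‖(EuclideanSpace.single i (1 : ℝ) - EuclideanSpace.single j (1 : ℝ) :
      EuclideanSpace ℝ (Fin n))‖) (Eventually.of_forall fun ω => ?_)
  rw [exchange, norm_smul]
  exact mul_le_mul_of_nonneg_right (abs_transfer_le A B s t ω) (norm_nonneg _)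

/-- The element of least norm does not take oppositely ordered values on two sets of positive
measure. -/
lemma measure_eq_zero_or_of_minimal [IsFiniteMeasure μ]
    {f : Lp (EuclideanSpace ℝ (Fin n)) 2 μ} (hf : f ∈ concaveImprovements μ M S Y)
    (hmin : ∀ w ∈ concaveImprovements μ M S Y, 0 ≤ inner ℝ f (w - f)) (i j : Fin n)
    {c₁ c₂ d₁ d₂ : ℝ} (hc : c₁ < c₂) (hd : d₁ < d₂) :
    μ {ω | c₂ ≤ f ω i ∧ f ω j ≤ d₁} = 0 ∨ μ {ω | f ω i ≤ c₁ ∧ d₂ ≤ f ω j} = 0 := by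
  by_contra! hcon
  set A := {ω | c₂ ≤ f ω i ∧ f ω j ≤ d₁}
  set B := {ω | f ω i ≤ c₁ ∧ d₂ ≤ f ω j}
  obtain ⟨hA0, hB0⟩ := hcon
  have hmeas : ∀ l, Measurable fun ω => f ω l := fun l =>
    (continuous_coord l).measurable.comp
      (Lp.stronglyMeasurable f).measurable
  have hA : MeasurableSet A := (measurableSet_le measurable_const (hmeas i)).inter
    (measurableSet_le (hmeas j) measurable_const)
  have hB : MeasurableSet B := (measurableSet_le (hmeas i) measurable_const).inter
    (measurableSet_le measurable_const (hmeas j))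
  have hApos : 0 < μ.real A := (measureReal_nonneg).lt_of_ne' (by simpa [measureReal_def,
    ENNReal.toReal_eq_zero_iff] using hA0)
  have hBpos : 0 < μ.real B := (measureReal_nonneg).lt_of_ne' (by simpa [measureReal_def,
    ENNReal.toReal_eq_zero_iff] using hB0)
  obtain ⟨hf₁, hf₂, hf₃⟩ := id hf
  have hex : ∀ E : Set Ω, μ E ≠ 0 → ∃ ω ∈ E, ∀ l, |f ω l| ≤ M := fun E hE => by
    obtain ⟨ω, h, h'⟩ := ((frequently_ae_mem_iff.2 hE).and_eventually hf₂).exists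
    exact ⟨ω, h, h'⟩
  obtain ⟨α, hα, hαM⟩ := hex A hA0
  obtain ⟨β, hβ, hβM⟩ := hex B hB0
  have hij : i ≠ j := by
    rintro rfl
    linarith [hα.1, hα.2, hβ.1, hβ.2]
  -- Half the smaller gap: `f i` and `f j` stay at distance at least `δ` from the midpoints of their
  -- gaps on `A` and on `B`.
  set δ := min ((c₂ - c₁) / 2) ((d₂ - d₁) / 2)
  have hδ : 0 < δ := lt_min (by linarith) (by linarith)
  have hδc : δ ≤ (c₂ - c₁) / 2 := min_le_left _ _
  have hδd : δ ≤ (d₂ - d₁) / 2 := min_le_right _ _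
  -- Amounts proportional to the measure of the opposite set balance the means; this scale gives `s
  -- + t = δ`, so both are below `δ`.
  set ε := δ / (μ.real A + μ.real B) with hεdef
  have hε : 0 < ε := by positivity
  have hεδ : ε * (μ.real A + μ.real B) = δ := by
    rw [hεdef]; field_simp
  set s := ε * μ.real B with hsdef
  set t := ε * μ.real A with htdef
  have hs : 0 < s := by positivity
  have ht : 0 < t := by positivity
  have hst : s + t = δ := by rw [← hεδ]; ring
  have hbal : μ.real B * t = μ.real A * s := by rw [hsdef, htdef]; ring
  clear_value s t ε δ
  have hcM : |(c₁ + c₂) / 2| ≤ M := by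
    have h1 := abs_le.1 (hαM i)
    have h2 := abs_le.1 (hβM i)
    rw [abs_le]
    constructor <;> linarith [hα.1, hβ.1]
  have hdM : |(d₁ + d₂) / 2| ≤ M := by
    have h1 := abs_le.1 (hαM j)
    have h2 := abs_le.1 (hβM j)
    rw [abs_le]
    constructor <;> linarith [hα.2, hβ.2]
  have hiA : ∀ ω ∈ A, (c₁ + c₂) / 2 + δ ≤ f ω i := fun ω h => by linarith [h.1]
  have hiB : ∀ ω ∈ B, f ω i ≤ (c₁ + c₂) / 2 - δ := fun ω h => by linarith [h.1]
  have hjA : ∀ ω ∈ A, f ω j ≤ (d₁ + d₂) / 2 - δ := fun ω h => by linarith [h.2]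
  have hjB : ∀ ω ∈ B, (d₁ + d₂) / 2 + δ ≤ f ω j := fun ω h => by linarith [h.2]
  have hmem := memLp_exchange (μ := μ) hA hB s t i j
  set h := hmem.toLp
  have hh : ∀ᵐ ω ∂μ, h ω = exchange A B s t i j ω := hmem.coeFn_toLp
  obtain ⟨w, hwdef⟩ : ∃ w, w = f + h := ⟨_, rfl⟩
  have hw : ∀ᵐ ω ∂μ, w ω = f ω + exchange A B s t i j ω := by
    filter_upwards [Lp.coeFn_add f h, hh] with ω h1 h2
    rw [hwdef, h1, Pi.add_apply, h2]
  have hwi : ∀ ω, (f ω + exchange A B s t i j ω) i = f ω i + transfer A B s t ω := fun ω => by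
    simp [exchange, hij]
  have hwj : ∀ ω, (f ω + exchange A B s t i j ω) j = f ω j + transfer B A t s ω := fun ω => by
    simp [exchange, hij.symm, transfer_swap_neg A B]
  have hwl : ∀ ω l, l ≠ i → l ≠ j → (f ω + exchange A B s t i j ω) l = f ω l :=
    fun ω l hi hj => by simp [exchange, hi, hj]
  have hwmem : w ∈ concaveImprovements μ M S Y := by
    refine ⟨?_, ?_, fun l φ hφ => ?_⟩
    · filter_upwards [hw, hf₁] with ω h1 h2
      simp [h1, exchange, Finset.sum_add_distrib, h2, ← Finset.mul_sum]
    · filter_upwards [hw, hf₂] with ω h1 h2 l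
      rw [h1]
      by_cases hli : l = i
      · subst hli
        rw [hwi]
        exact abs_add_transfer_le hδ hiA hiB hs.le (by linarith) ht.le (by linarith) hcM (h2 _)
      by_cases hlj : l = j
      · subst hlj
        rw [hwj]
        exact abs_add_transfer_le hδ hjB hjA ht.le (by linarith) hs.le (by linarith) hdM (h2 _)
      · rw [hwl ω l hli hlj]
        exact h2 l
    · refine (hf₃ l φ hφ).trans ?_
      have hint : ∫ ω, φ (w ω l) ∂μ = ∫ ω, φ ((f ω + exchange A B s t i j ω) l) ∂μ :=
        integral_congr_ae (hw.mono fun ω h1 => by simp only [h1])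
      rw [hint]
      by_cases hli : l = i
      · subst hli
        simp only [hwi]
        exact integral_le_integral_add_transfer hφ (hmeas _).aestronglyMeasurable hA hB hδ hiA hiB
          hs (by linarith) ht (by linarith) hcM (hf₂.mono fun ω h => h _) hbal
      by_cases hlj : l = j
      · subst hlj
        simp only [hwj]
        exact integral_le_integral_add_transfer hφ (hmeas _).aestronglyMeasurable hB hA hδ hjB hjA
          ht (by linarith) hs (by linarith) hdM (hf₂.mono fun ω h => h _) hbal.symm
      · simp only [hwl _ l hli hlj, le_refl]
  have hinner := hmin _ hwmem
  rw [hwdef, add_sub_cancel_left, L2.inner_def] at hinner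
  -- The integrand is the transfer times `f i - f j`, which is at least `c₂ - d₁` on `A` and at most
  -- `c₁ - d₂` on `B`. By balance the bound integrates to a negative number.
  have hle : ∫ ω, inner ℝ (f ω) (h ω) ∂μ
      ≤ ∫ ω, transfer A B (s * (c₂ - d₁)) (t * (c₁ - d₂)) ω ∂μ := by
    refine integral_mono_ae (L2.integrable_inner f h) (integrable_transfer hA hB _ _) ?_
    filter_upwards [hh] with ω h1
    have h2 : inner ℝ (f ω) (h ω) = transfer A B s t ω * (f ω i - f ω j) := by
      simp [h1, exchange, inner_smul_right, inner_sub_right,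
        EuclideanSpace.inner_single_right]
    rw [h2]
    by_cases hA : ω ∈ A <;> by_cases hB : ω ∈ B <;> simp only [transfer, hA, hB,
      not_false_eq_true, Set.indicator_of_mem, Set.indicator_of_notMem]
    · linarith [hiA ω hA, hiB ω hB]
    · nlinarith [hA.1, hA.2]
    · nlinarith [hB.1, hB.2]
    · simp
  rw [integral_transfer hA hB] at hle
  have h3 : μ.real B * (t * (c₁ - d₂)) - μ.real A * (s * (c₂ - d₁))
      = μ.real B * t * (c₁ - c₂ + (d₁ - d₂)) := by
    rw [← mul_assoc, ← mul_assoc, ← hbal]; ring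
  rw [h3] at hle
  have h4 : μ.real B * t * (c₁ - c₂ + (d₁ - d₂)) < 0 :=
    mul_neg_of_pos_of_neg (by positivity) (by linarith)
  linarith

end Improvements

/-! ### Comonotone versions and comonotone improvement -/

/-- Random variables that are almost surely ordered alike have comonotone versions. -/
lemma exists_comonotone_versions [NeZero μ] {f : Fin n → Ω → ℝ} (hf : ∀ i, Measurable (f i))
    (h : ∀ i j, ∀ c₁ c₂ d₁ d₂ : ℝ, c₁ < c₂ → d₁ < d₂ →
      μ {ω | c₂ ≤ f i ω ∧ f j ω ≤ d₁} = 0 ∨ μ {ω | f i ω ≤ c₁ ∧ d₂ ≤ f j ω} = 0) :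
    ∃ Z : Fin n → Ω → ℝ, (∀ i, Measurable (Z i)) ∧ (∀ i, f i =ᵐ[μ] Z i) ∧
      ∀ (ω₁ ω₂ : Ω) (i j : Fin n), 0 ≤ (Z i ω₁ - Z i ω₂) * (Z j ω₁ - Z j ω₂) := by
  -- Rational thresholds suffice to separate values, and only countably many null sets are
  -- discarded.
  have hae : ∀ᵐ ω ∂μ, ∀ (i j : Fin n) (c₁ c₂ d₁ d₂ : ℚ),
      (μ {ω | (c₂ : ℝ) ≤ f i ω ∧ f j ω ≤ d₁} = 0 → ¬ ((c₂ : ℝ) ≤ f i ω ∧ f j ω ≤ d₁)) ∧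
      (μ {ω | f i ω ≤ c₁ ∧ (d₂ : ℝ) ≤ f j ω} = 0 → ¬ (f i ω ≤ c₁ ∧ (d₂ : ℝ) ≤ f j ω)) := by
    simp only [ae_all_iff]
    intro i j c₁ c₂ d₁ d₂
    have himp : ∀ E : Set Ω, ∀ᵐ ω ∂μ, μ E = 0 → ω ∉ E := fun E => by
      by_cases hE : μ E = 0
      · exact (measure_eq_zero_iff_ae_notMem.1 hE).mono fun ω h _ => h
      · exact Eventually.of_forall fun ω h => absurd h hE
    exact (himp _).and (himp _)
  obtain ⟨G, hGsub, hGmeas, hG⟩ : ∃ G : Set Ω, G ⊆ {ω | ∀ (i j : Fin n) (c₁ c₂ d₁ d₂ : ℚ),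
      (μ {ω | (c₂ : ℝ) ≤ f i ω ∧ f j ω ≤ d₁} = 0 → ¬ ((c₂ : ℝ) ≤ f i ω ∧ f j ω ≤ d₁)) ∧
      (μ {ω | f i ω ≤ c₁ ∧ (d₂ : ℝ) ≤ f j ω} = 0 → ¬ (f i ω ≤ c₁ ∧ (d₂ : ℝ) ≤ f j ω))} ∧
      MeasurableSet G ∧ ∀ᵐ ω ∂μ, ω ∈ G := by
    obtain ⟨T, hT, hTm, hT0⟩ := exists_measurable_superset_of_null (mem_ae_iff.1 hae)
    exact ⟨Tᶜ, Set.compl_subset_comm.1 hT, hTm.compl, measure_eq_zero_iff_ae_notMem.1 hT0⟩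
  -- Off the good set `G` all components take their values at this one point, so every value vector
  -- is attained on `G`.
  obtain ⟨ω₀, hω₀⟩ := hG.exists
  have hord : ∀ ω₁ ∈ G, ∀ ω₂ ∈ G, ∀ i j, ¬ (f i ω₂ < f i ω₁ ∧ f j ω₁ < f j ω₂) := by
    rintro ω₁ h₁ ω₂ h₂ i j ⟨hi, hj⟩
    obtain ⟨c₂, hc₂, hc₂'⟩ := exists_rat_btwn hi
    obtain ⟨c₁, hc₁, hc₁'⟩ := exists_rat_btwn hc₂
    obtain ⟨d₂, hd₂, hd₂'⟩ := exists_rat_btwn hj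
    obtain ⟨d₁, hd₁, hd₁'⟩ := exists_rat_btwn hd₂
    rcases h i j c₁ c₂ d₁ d₂ hc₁' hd₁' with h0 | h0
    · exact (hGsub h₁ i j c₁ c₂ d₁ d₂).1 h0 ⟨hc₂'.le, hd₁.le⟩
    · exact (hGsub h₂ i j c₁ c₂ d₁ d₂).2 h0 ⟨hc₁.le, hd₂'.le⟩
  have hmul : ∀ ω₁ ∈ G, ∀ ω₂ ∈ G, ∀ i j, 0 ≤ (f i ω₁ - f i ω₂) * (f j ω₁ - f j ω₂) := by
    intro ω₁ h₁ ω₂ h₂ i j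
    by_contra! hneg
    rcases mul_neg_iff.1 hneg with ⟨h3, h4⟩ | ⟨h3, h4⟩
    · exact hord ω₁ h₁ ω₂ h₂ i j ⟨by linarith, by linarith⟩
    · exact hord ω₂ h₂ ω₁ h₁ i j ⟨by linarith, by linarith⟩
  classical
  have hpick : ∀ ω, ∃ ω' ∈ G, ∀ i, G.piecewise (f i) (fun _ => f i ω₀) ω = f i ω' := by
    intro ω
    by_cases hω : ω ∈ G
    · exact ⟨ω, hω, fun i => by simp [hω]⟩
    · exact ⟨ω₀, hω₀, fun i => by simp [hω]⟩
  refine ⟨fun i => G.piecewise (f i) (fun _ => f i ω₀),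
    fun i => (hf i).piecewise hGmeas measurable_const, fun i => ?_, fun ω₁ ω₂ i j => ?_⟩
  · filter_upwards [hG] with ω hω
    simp [hω]
  · obtain ⟨ω₁', h₁, e₁⟩ := hpick ω₁
    obtain ⟨ω₂', h₂, e₂⟩ := hpick ω₂
    simp only [e₁, e₂]
    exact hmul ω₁' h₁ ω₂' h₂ i j

/-- Comonotone improvement: every allocation is dominated, component by component and in the
increasing concave order, by a comonotone allocation of the same aggregate. -/
theorem exists_comonotone_improvement [IsProbabilityMeasure μ] (Y : Fin n → LInfty μ) :
    ∃ Z : Fin n → LInfty μ, ∑ i, Z i = ∑ i, Y i ∧ Comonotone Z ∧ ∀ i, ICVLe μ (Y i) (Z i) := by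
  set M := ∑ i, lpNorm (Y i) ⊤ μ
  have hYM : ∀ᵐ ω ∂μ, ∀ i, |Y i ω| ≤ M := by
    refine ae_all_iff.2 fun i => ?_
    filter_upwards [ae_le_lpNorm_exponent_top (Lp.memLp (Y i))] with ω h
    exact h.trans (Finset.single_le_sum (f := fun i => lpNorm (Y i) ⊤ μ) (fun _ _ => lpNorm_nonneg)
      (Finset.mem_univ i))
  set K := concaveImprovements μ M (fun ω => ∑ i, Y i ω) (fun i => Y i)
  have hYmem : MemLp (fun ω => (WithLp.toLp 2 fun i => Y i ω : EuclideanSpace ℝ (Fin n))) 2 μ :=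
    MemLp.of_eval_piLp fun i => (Lp.memLp (Y i)).mono_exponent le_top
  have hKne : K.Nonempty := by
    have hco := hYmem.coeFn_toLp
    refine ⟨hYmem.toLp, ?_, ?_, fun i φ hφ => le_of_eq (integral_congr_ae ?_)⟩
    · filter_upwards [hco] with ω h
      simp [h]
    · filter_upwards [hco, hYM] with ω h h' i
      simpa [h] using h' i
    · filter_upwards [hco] with ω h
      simp [h]
  have hconv : Convex ℝ K := convex_concaveImprovements
  obtain ⟨f, hfK, hfmin⟩ := exists_norm_eq_iInf_of_complete_convex hKne
    (isClosed_concaveImprovements.isComplete) hconv 0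
  -- Variational inequality for the projection of `0` onto `K`.
  have hmin : ∀ w ∈ K, 0 ≤ inner ℝ f (w - f) := by
    intro w hw
    have := (norm_eq_iInf_iff_real_inner_le_zero hconv hfK).1 hfmin w hw
    rw [zero_sub, inner_neg_left] at this
    linarith
  have hmeas : ∀ l, Measurable fun ω => f ω l := fun l =>
    (continuous_coord l).measurable.comp
      (Lp.stronglyMeasurable f).measurable
  have hmem : ∀ i, MemLp (fun ω => f ω i) ⊤ μ := fun i =>
    memLp_top_of_bound (hmeas i).aestronglyMeasurable M (hfK.2.1.mono fun ω h => h i)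
  have hco : ∀ᵐ ω ∂μ, ∀ i, (hmem i).toLp _ ω = f ω i :=
    ae_all_iff.2 fun i => (hmem i).coeFn_toLp
  refine ⟨fun i => (hmem i).toLp _, ?_, ?_, fun i φ _ hφ _ _ => ?_⟩
  · refine Lp.ext ?_
    filter_upwards [hco, hfK.1, Lp.coeFn_finsetSum Finset.univ fun i => (hmem i).toLp _,
      Lp.coeFn_finsetSum Finset.univ Y] with ω h1 h2 h3 h4
    rw [h3, h4]
    simpa [h1] using h2
  · obtain ⟨Z, hZ, hfZ, hcom⟩ := exists_comonotone_versions (μ := μ) hmeas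
      fun i j c₁ c₂ d₁ d₂ hc hd => measure_eq_zero_or_of_minimal hfK hmin i j hc hd
    exact ⟨Z, hZ, fun i => ((hmem i).coeFn_toLp).trans (hfZ i), hcom⟩
  · refine (hfK.2.2 i φ hφ).trans_eq (integral_congr_ae ?_)
    filter_upwards [hco] with ω h
    rw [h i]

lemma exists_comonotone_IR_improvement [IsProbabilityMeasure μ] {X : Fin n → LInfty μ}
    {U : Fin n → LInfty μ → ℝ} (hssd : ∀ i, SSDPreserving μ (U i)) {Y : Fin n → LInfty μ}
    (hY : Y ∈ IR U X) :
    ∃ Z ∈ IR U X ∩ comonotoneAllocations X, ∀ i, U i (Y i) ≤ U i (Z i) := by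
  obtain ⟨Z, hZ, hcom, hle⟩ := exists_comonotone_improvement Y
  have hZX : Z ∈ allocations X := hZ.trans hY.1
  have hU : ∀ i, U i (Y i) ≤ U i (Z i) := fun i => hssd i _ _ (hle i)
  exact ⟨Z, ⟨⟨hZX, fun i => (hY.2 i).trans (hU i)⟩, hZX, hcom⟩, hU⟩

lemma Dominates.of_le {U : Fin n → LInfty μ → ℝ} {Y₁ Y₂ Z₁ Z₂ : Fin n → LInfty μ}
    (h : Dominates U Y₂ Y₁) (h₁ : ∀ i, U i (Z₁ i) ≤ U i (Y₁ i))
    (h₂ : ∀ i, U i (Y₂ i) ≤ U i (Z₂ i)) : Dominates U Z₂ Z₁ :=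
  ⟨fun i => (h₁ i).trans ((h.1 i).trans (h₂ i)),
    h.2.imp fun i hi => (h₁ i).trans_lt (hi.trans_le (h₂ i))⟩

end RiskSharing

theorem theorem3p8 {Ω : Type*} [MeasurableSpace Ω] (μ : Measure Ω) [IsProbabilityMeasure μ]
    (hμ : RiskSharing.Atomless μ) (n : ℕ)
    (X : Fin n → RiskSharing.LInfty μ) (U : Fin n → RiskSharing.LInfty μ → ℝ)
    (hconc : ∀ i, ConcaveOn ℝ Set.univ (U i))
    (hssd : ∀ i, RiskSharing.SSDPreserving μ (U i))
    (hcash : ∀ i, RiskSharing.IncreasingInCash μ (U i)) :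
    ((RiskSharing.PO U X).Nonempty ↔ (RiskSharing.CPO U X).Nonempty) ∧
    ((RiskSharing.PO U X).Nonempty → (RiskSharing.CPO U X).Nonempty →
      ∀ l ∈ RiskSharing.weights n,
        RiskSharing.weightedSup U l (RiskSharing.IR U X) =
          RiskSharing.weightedSup U l
            (RiskSharing.IR U X ∩ RiskSharing.comonotoneAllocations X)) := by
  refine ⟨⟨?_, ?_⟩, fun _ _ l hl => le_antisymm ?_ ?_⟩
  · rintro ⟨Y, hY, hopt⟩
    obtain ⟨Z, hZ, hYZ⟩ := RiskSharing.exists_comonotone_IR_improvement hssd hY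
    exact ⟨Z, hZ, fun ⟨W, hW, hdom⟩ =>
      hopt ⟨W, hW.1, hdom.of_le hYZ fun _ => le_rfl⟩⟩
  -- The same `Y` is Pareto optimal: the comonotone improvement of a dominating allocation would
  -- dominate it too.
  · rintro ⟨Y, hY, hopt⟩
    refine ⟨Y, hY.1, fun ⟨W, hW, hdom⟩ => ?_⟩
    obtain ⟨Z, hZ, hWZ⟩ := RiskSharing.exists_comonotone_IR_improvement hssd hW
    exact hopt ⟨Z, hZ, hdom.of_le (fun _ => le_rfl) hWZ⟩
  · refine iSup₂_le fun Y hY => ?_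
    obtain ⟨Z, hZ, hYZ⟩ := RiskSharing.exists_comonotone_IR_improvement hssd hY
    refine le_iSup₂_of_le Z hZ (EReal.coe_le_coe_iff.2 ?_)
    exact Finset.sum_le_sum fun i _ => mul_le_mul_of_nonneg_left (hYZ i) (hl.1 i)
  · exact biSup_mono fun Y hY => hY.1
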